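/- Let $d\ge 1$, let $E_1,\dots,E_d$ be real energies, $\beta>0$, and let $\gamma_i = e^{-\beta E_i}/\sum_j e^{-\beta E_j}$ be the Gibbs distribution. Let $\Delta_d\subset\mathbb R^d$ be the probability simplex and $H=\{x\in\mathbb R^d:\sum_i x_i=1\}$. A matrix $\Lambda\in\mathbb R^{d\times d}$ is \emph{Gibbs-preserving} if $\Lambda_{ij}\ge 0$, $\sum_i\Lambda_{ij}=1$ for all $j$, and $\Lambda\gamma=\gamma$. For $t\in H$ let $\mathcal T^\beta_+(t)=\{\Lambda t:\Lambda\text{ Gibbs-preserving}\}$. For $p\in\Delta_d$ let $\mathcal T^\beta_-(p)$ be the set of all $q\in\Delta_d$ such that $\Lambda q=p$ for some Gibbs-preserving $\Lambda$ (the past thermal cone of $p$). Let $p\in\Delta_d$, and let $\pi_p\in\mathcal S_d$ be any permutation for which $p_{\pi_p^{-1}(i)}/\gamma_{\pi_p^{-1}(i)}$ is non-increasing in $i$; write $p^\beta_i=p_{\pi_p^{-1}(i)}$ and $\gamma^\beta_i=\gamma_{\pi_p^{-1}(i)}$. If $d\ge 2$, then for $\pi\in\mathcal S_d$ and $n\in\{1,\dots,d\}$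 define $t^{(n,\pi)}\in H$ by $$t^{(n,\pi)}_{\pi(1)}=\sum_{i=1}^n p^\beta_i-\frac{p^\beta_n}{\gamma^\beta_n}\Big(\sum_{i=1}^n\gamma^\beta_i-\gamma_{\pi(1)}\Big),\qquad t^{(n,\pi)}_{\pi(i)}=\frac{p^\beta_n}{\gamma^\beta_n}\gamma_{\pi(i)}\quad(2\le i\le d-1),$$ $$t^{(n,\pi)}_{\pi(d)}=1-t^{(n,\pi)}_{\pi(1)}-\frac{p^\beta_n}{\gamma^\beta_n}\sum_{i=2}^{d-1}\gamma_{\pi(i)}.$$ Let $$\mathbb T^\beta=\bigcup_{\pi\in\mathcal S_d}\ \bigcup_{n=1}^{d-1}\operatorname{conv}\Big[\mathcal T^\beta_+\big(t^{(n,\pi)}\big)\cup\mathcal T^\beta_+\big(t^{(n+1,\pi)}\big)\Big]\subset H$$ (so $\mathbb T^\beta=\emptyset$ if $d=1$), and let $\operatorname{int}(\mathbb T^\beta)$ be its interior relative to the hyperplane $H$. Then $$\mathcal T^\beta_-(p)=\Delta_d\setminus\operatorname{int}(\mathbb T^\beta).$$ -/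

import Mathlib

open scoped Matrix

namespace ThermalCone

/-- The Gibbs distribution `γ_i = e^{-β E_i} / Z`, with `Z = ∑ j, e^{-β E_j}`. -/
noncomputable def gibbs {d : ℕ} (β : ℝ) (E : Fin d → ℝ) : Fin d → ℝ :=
  fun i => Real.exp (-(β * E i)) / ∑ j, Real.exp (-(β * E j))

/-- Gibbs-preserving matrices: column-stochastic matrices `Λ` with `Λ γ = γ`. -/
structure IsGibbsPreserving {d : ℕ} (γ : Fin d → ℝ) (Λ : Matrix (Fin d) (Fin d) ℝ) : Prop where
  nonneg : ∀ i j, 0 ≤ Λ i j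
  col_sum : ∀ j, ∑ i, Λ i j = 1
  fixed : Λ *ᵥ γ = γ

/-- The future thermal cone: all vectors that `p` is mapped to by Gibbs-preserving matrices.
It is also used for quasi-probability vectors `p`, whose entries may be negative. -/
def futureCone {d : ℕ} (β : ℝ) (E p : Fin d → ℝ) : Set (Fin d → ℝ) :=
  {q | ∃ Λ : Matrix (Fin d) (Fin d) ℝ, IsGibbsPreserving (gibbs β E) Λ ∧ Λ *ᵥ p = q}

/-- The past thermal cone: all states (probability vectors) that are mapped to `p` by some
Gibbs-preserving matrix. -/
def pastCone {d : ℕ} (β : ℝ) (E p : Fin d → ℝ) : Set (Fin d → ℝ) :=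
  {q | q ∈ stdSimplex ℝ (Fin d) ∧
    ∃ Λ : Matrix (Fin d) (Fin d) ℝ, IsGibbsPreserving (gibbs β E) Λ ∧ Λ *ᵥ q = p}

/-- `π` is a `β`-ordering of `p`: the ratios `p_{π⁻¹(i)} / γ_{π⁻¹(i)}` are non-increasing in `i`. -/
def IsBetaOrder {d : ℕ} (β : ℝ) (E p : Fin d → ℝ) (π : Equiv.Perm (Fin d)) : Prop :=
  Antitone fun i => p (π.symm i) / gibbs β E (π.symm i)

/-- Every vector has a `β`-ordering. -/
theorem exists_isBetaOrder {d : ℕ} (β : ℝ) (E p : Fin d → ℝ) :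
    ∃ π : Equiv.Perm (Fin d), IsBetaOrder β E p π := by
  refine ⟨(Tuple.sort fun i => -(p i / gibbs β E i)).symm, fun i j hij => ?_⟩
  have h := Tuple.monotone_sort (fun i => -(p i / gibbs β E i)) hij
  simp only [Function.comp_apply] at h
  simpa using h

section Tangent

variable {d : ℕ} (β : ℝ) (E p : Fin d → ℝ) (πp : Equiv.Perm (Fin d))

/-- The slope `p^β_n / γ^β_n` of the `n`-th linear piece of the thermomajorisation curve of `p`,
where `p^β_n = p_{π_p⁻¹(n)}` and `γ^β_n = γ_{π_p⁻¹(n)}` for the `β`-ordering `π_p` of `p`. -/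
noncomputable def slope (n : Fin d) : ℝ :=
  p (πp.symm n) / gibbs β E (πp.symm n)

/-- The first entry of the tangent vector with indices `n` and `π`; here `x` is `γ_{π(1)}`:
`∑_{i ≤ n} p^β_i - (p^β_n / γ^β_n) (∑_{i ≤ n} γ^β_i - γ_{π(1)})`. -/
noncomputable def firstEntry (n : Fin d) (x : ℝ) : ℝ :=
  (∑ i ∈ Finset.Iic n, p (πp.symm i)) -
    slope β E p πp n * ((∑ i ∈ Finset.Iic n, gibbs β E (πp.symm i)) - x)

/-- The thermal tangent vector with indices `n` and `π`, listed in the order `π`. The first entry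
is `firstEntry`, the middle entries are `(p^β_n / γ^β_n) γ_{π(i)}`, and the last entry makes the
total equal to `1`. -/
noncomputable def tangentOrdered (n : Fin d) (π : Equiv.Perm (Fin d)) : Fin d → ℝ := fun i =>
  if i.val = 0 then firstEntry β E p πp n (gibbs β E (π i))
  else if i.val + 1 < d then slope β E p πp n * gibbs β E (π i)
  else 1 - firstEntry β E p πp n (gibbs β E (π ⟨0, i.pos⟩)) -
    slope β E p πp n *
      ∑ j ∈ Finset.univ.filter (fun j : Fin d => 0 < j.val ∧ j.val + 1 < d), gibbs β E (π j)

/-- The thermal tangent vector `t^(n,π)`: its component at the energy level `π i` is the `i`-th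
entry of the ordered list. -/
noncomputable def tangent (n : Fin d) (π : Equiv.Perm (Fin d)) : Fin d → ℝ :=
  fun l => tangentOrdered β E p πp n π (π.symm l)

/-- The set `𝕋^β`: the union, over all permutations `π` and all pairs of consecutive indices
`n, n + 1` (counted from `0` here), of the convex hull of the two future thermal cones
of `t^(n,π)` and `t^(n+1,π)`. -/
def tangentSet : Set (Fin d → ℝ) :=
  ⋃ π : Equiv.Perm (Fin d), ⋃ n : ℕ, ⋃ h : n + 1 < d,
    convexHull ℝ (futureCone β E (tangent β E p πp ⟨n, Nat.lt_of_succ_lt h⟩ π) ∪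
      futureCone β E (tangent β E p πp ⟨n + 1, h⟩ π))

end Tangent

/-- The affine hyperplane of normalised vectors (quasi-probability distributions). -/
def normalised (d : ℕ) : Set (Fin d → ℝ) := {x | ∑ i, x i = 1}

/-- The interior of a set of normalised vectors, in the topology of the hyperplane of all
normalised vectors. -/
def normalisedInterior {d : ℕ} (S : Set (Fin d → ℝ)) : Set (Fin d → ℝ) :=
  Subtype.val '' interior ((Subtype.val : normalised d → (Fin d → ℝ)) ⁻¹' S)

end ThermalCone

namespace ThermalCone

/-! Write e_q(c) = ∑ max(q_i - cγ_i, 0) (`excess`); up to sign conventions this is the Legendre dual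
of the thermomajorisation curve of q. For vectors of equal total, a Gibbs-preserving matrix maps q
to p exactly when e_p ≤ e_q everywhere (`excess_mulVec_le`, `exists_isGibbsPreserving`). A state q
thus misses the past cone exactly when e_q(c) < e_p(c) for some c.

A normalised q lies in the tangent set exactly when e_q(s) ≤ e_p(s) for some s between two
consecutive slopes of the curve of p (`exists_excess_le_of_mem_tangentSet`,
`mem_tangentSet_of_excess_le`). The reason is that the tangent vectors follow the lines touching
that curve, and e_p is affine between consecutive slopes, so intermediate tangents are convex
combinations.

A strict inequality e_q(c) < e_p(c) is an open condition and forces c into the slope range, so q is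
interior. Conversely, if q is mapped to p, moving a little weight from the smallest to the largest
ratio of q lifts its excess strictly above e_p at all these slopes, so q has neighbours outside the
tangent set. -/

open Finset

/-! ### Interpolating convex functions by hinges -/

section ConvexOrder

/-- A linear functional that vanishes on affine functions and is nonnegative on hinge functions is
nonnegative, up to interpolation at finitely many points, on functions with subgradients. -/
theorem exists_interpolation_of_subgradient (L : (ℝ → ℝ) →ₗ[ℝ] ℝ) (hone : L (fun _ => 1) = 0)
    (hid : L (fun x => x) = 0) (hhinge : ∀ c, 0 ≤ L (fun x => max (x - c) 0)) (φ : ℝ → ℝ)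
    (hφ : ∀ x, ∃ k, ∀ y, φ x + k * (y - x) ≤ φ y) (S : Finset ℝ) (hS : S.Nonempty) :
    ∃ g : ℝ → ℝ, (∀ x ∈ S, g x = φ x) ∧ 0 ≤ L g ∧ ∃ m ∈ S, (∀ x ∈ S, x ≤ m) ∧
      ∃ k, ∀ x, m ≤ x → g x = φ m + k * (x - m) ∧ g x ≤ φ x := by
  induction S using Finset.induction_on_max with
  | empty => exact absurd hS (by simp)
  | insert r S hr ih =>
    rcases S.eq_empty_or_nonempty with rfl | hne
    · obtain ⟨k, hk⟩ := hφ r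
      refine ⟨fun x => φ r + k * (x - r), by simp, ?_, r, by simp, by simp, k,
        fun x _ => ⟨rfl, hk x⟩⟩
      have : (fun x => φ r + k * (x - r)) =
          (φ r - k * r) • (fun _ : ℝ => (1 : ℝ)) + k • (fun x : ℝ => x) := by
        funext x; simp; ring
      rw [this, map_add, map_smul, map_smul, hone, hid]
      simp
    · obtain ⟨g, hg, hLg, m, hm, hmax, k, hk⟩ := ih hne
      have hmr : m < r := hr m hm
      have hpos : 0 < r - m := sub_pos.2 hmr
      have hgr := hk r hmr.le
      -- The hinge coefficient that lifts the interpolant to φ at r; it is nonnegative because g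
      -- stays below φ to the right of m.
      set a := (φ r - g r) / (r - m) with ha
      have ha0 : 0 ≤ a := div_nonneg (by linarith [hgr.2]) hpos.le
      have har : a * (r - m) = φ r - g r := by rw [ha]; field_simp
      refine ⟨g + a • (fun x => max (x - m) 0), ?_, ?_, r, by simp, ?_, k + a, ?_⟩
      · intro x hx
        rcases Finset.mem_insert.1 hx with rfl | hx
        · simp only [Pi.add_apply, Pi.smul_apply, smul_eq_mul]
          rw [max_eq_left hpos.le]; linarith
        · simp only [Pi.add_apply, Pi.smul_apply, smul_eq_mul]
          rw [max_eq_right (by linarith [hmax x hx]), hg x hx]; ring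
      · rw [map_add, map_smul]
        exact add_nonneg hLg (mul_nonneg ha0 (hhinge m))
      · intro x hx
        rcases Finset.mem_insert.1 hx with rfl | hx
        · exact le_rfl
        · exact (hr x hx).le
      · intro x hx
        have hgx := (hk x (hmr.le.trans hx)).1
        obtain ⟨l, hl⟩ := hφ r
        have hlm := hl m
        have hlx := hl x
        have hval : g x + a * max (x - m) 0 = φ r + (k + a) * (x - r) := by
          rw [max_eq_left (by linarith), hgx]
          have := hgr.1
          linear_combination har - this
        -- The new slope is the secant slope of φ from m to r, hence at most any subgradient at r.
        -- This keeps the interpolant below φ beyond r.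
        have hslope : k + a ≤ l := by
          by_contra hcon
          push Not at hcon
          have h1 : φ r = φ m + (k + a) * (r - m) := by
            have := hgr.1
            linear_combination this - har
          nlinarith
        refine ⟨by simpa using hval, ?_⟩
        simp only [Pi.add_apply, Pi.smul_apply, smul_eq_mul]
        rw [hval]
        have := mul_le_mul_of_nonneg_right hslope (sub_nonneg.2 hx)
        linarith

end ConvexOrder

/-! ### The excess function -/

section Excess

variable {ι : Type*} [Fintype ι]

/-- The total excess of `q` over `c • γ`. -/
noncomputable def excess (γ q : ι → ℝ) (c : ℝ) : ℝ := ∑ i, max (q i - c * γ i) 0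

theorem excess_nonneg (γ q : ι → ℝ) (c : ℝ) : 0 ≤ excess γ q c :=
  Finset.sum_nonneg fun _ _ => le_max_right _ _

theorem excess_eq_deficit {γ q : ι → ℝ} (hγ : ∑ i, γ i = 1) (hq : ∑ i, q i = 1) (c : ℝ) :
    excess γ q c = 1 - c + ∑ i, max (c * γ i - q i) 0 := by
  have h : ∀ i, max (q i - c * γ i) 0 = (q i - c * γ i) + max (c * γ i - q i) 0 := by
    intro i
    rcases le_total (q i) (c * γ i) with h | h
    · rw [max_eq_right (by linarith), max_eq_left (by linarith)]; ring
    · rw [max_eq_left (by linarith), max_eq_right (by linarith)]; ring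
  unfold excess
  rw [Finset.sum_congr rfl fun i _ => h i, Finset.sum_add_distrib, Finset.sum_sub_distrib,
    ← Finset.mul_sum, hγ, hq]
  ring

theorem one_sub_le_excess {γ q : ι → ℝ} (hγ : ∑ i, γ i = 1) (hq : ∑ i, q i = 1) (c : ℝ) :
    1 - c ≤ excess γ q c := by
  rw [excess_eq_deficit hγ hq]
  linarith [Finset.sum_nonneg fun i (_ : i ∈ univ) => le_max_right (c * γ i - q i) 0]

theorem continuous_excess (γ : ι → ℝ) (c : ℝ) : Continuous fun q => excess γ q c := by
  unfold excess; fun_prop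

/-- Each summand is jointly convex in the vector and the slope, being the positive part of a linear
form. -/
theorem excess_combo_le (γ q r : ι → ℝ) {a b : ℝ} (ha : 0 ≤ a) (hb : 0 ≤ b) (s t : ℝ) :
    excess γ (a • q + b • r) (a * s + b * t) ≤ a * excess γ q s + b * excess γ r t := by
  unfold excess
  rw [Finset.mul_sum, Finset.mul_sum, ← Finset.sum_add_distrib]
  refine Finset.sum_le_sum fun i _ => max_le ?_ ?_
  · simp only [Pi.add_apply, Pi.smul_apply, smul_eq_mul]
    nlinarith [mul_le_mul_of_nonneg_left (le_max_left (q i - s * γ i) 0) ha,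
      mul_le_mul_of_nonneg_left (le_max_left (r i - t * γ i) 0) hb]
  · exact add_nonneg (mul_nonneg ha (le_max_right _ _)) (mul_nonneg hb (le_max_right _ _))

/-- The excess dominates in the sense of all convex functions with subgradients. -/
theorem sum_le_sum_of_excess_le {γ p q : ι → ℝ} (hγ : ∀ i, 0 < γ i)
    (hsum : ∑ i, p i = ∑ i, q i) (hle : ∀ c, excess γ p c ≤ excess γ q c) (φ : ℝ → ℝ)
    (hφ : ∀ x, ∃ k, ∀ y, φ x + k * (y - x) ≤ φ y) :
    ∑ i, γ i * φ (p i / γ i) ≤ ∑ i, γ i * φ (q i / γ i) := by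
  classical
  cases isEmpty_or_nonempty ι
  · simp
  -- On hinges this functional is the difference of the two excesses; it kills constants and, by
  -- equality of totals, the identity.
  let L : (ℝ → ℝ) →ₗ[ℝ] ℝ :=
    { toFun := fun f => ∑ i, γ i * f (q i / γ i) - ∑ i, γ i * f (p i / γ i)
      map_add' := fun f g => by
        simp only [Pi.add_apply, mul_add, Finset.sum_add_distrib]; ring
      map_smul' := fun a f => by
        simp only [Pi.smul_apply, smul_eq_mul, RingHom.id_apply, mul_sub, Finset.mul_sum]
        congr 1 <;> exact Finset.sum_congr rfl fun i _ => by ring }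
  have hL : ∀ f, L f = ∑ i, γ i * f (q i / γ i) - ∑ i, γ i * f (p i / γ i) := fun _ => rfl
  have hmul : ∀ (r : ι → ℝ) i, γ i * (r i / γ i) = r i := fun r i => by
    have := (hγ i).ne'
    field_simp
  have hhinge : ∀ (r : ι → ℝ) c, ∑ i, γ i * max (r i / γ i - c) 0 = excess γ r c := fun r c => by
    refine Finset.sum_congr rfl fun i _ => ?_
    rw [mul_max_of_nonneg _ _ (hγ i).le, mul_sub, hmul, mul_zero, mul_comm c]
  let S : Finset ℝ := univ.image (fun i => p i / γ i) ∪ univ.image (fun i => q i / γ i)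
  have hS : S.Nonempty := by simp [S]
  obtain ⟨g, hg, hLg, -⟩ := exists_interpolation_of_subgradient L (by rw [hL]; simp)
    (by rw [hL]; simp only [hmul, hsum, sub_self])
    (fun c => by rw [hL, hhinge, hhinge]; linarith [hle c]) φ hφ S hS
  rw [hL] at hLg
  have h1 : ∀ i, g (p i / γ i) = φ (p i / γ i) := fun i => hg _ (by simp [S])
  have h2 : ∀ i, g (q i / γ i) = φ (q i / γ i) := fun i => hg _ (by simp [S])
  simp only [h1, h2] at hLg
  linarith

end Excess

/-! ### Thermomajorisation and Gibbs-preserving matrices -/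

section Majorisation

variable {d : ℕ}

/-- Column-stochastic matrices. -/
def columnStochastic (d : ℕ) : Set (Matrix (Fin d) (Fin d) ℝ) :=
  {Λ | (∀ i j, 0 ≤ Λ i j) ∧ ∀ j, ∑ i, Λ i j = 1}

theorem convex_columnStochastic : Convex ℝ (columnStochastic d) := by
  intro A hA B hB a b ha hb hab
  refine ⟨fun i j => ?_, fun j => ?_⟩
  · simp only [Matrix.add_apply, Matrix.smul_apply, smul_eq_mul]
    exact add_nonneg (mul_nonneg ha (hA.1 i j)) (mul_nonneg hb (hB.1 i j))
  · simp only [Matrix.add_apply, Matrix.smul_apply, smul_eq_mul, Finset.sum_add_distrib,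
      ← Finset.mul_sum, hA.2 j, hB.2 j]
    linarith

theorem isCompact_columnStochastic : IsCompact (columnStochastic d) := by
  have hbox : IsCompact (Set.univ.pi fun _ : Fin d => Set.univ.pi fun _ : Fin d =>
      Set.Icc (0 : ℝ) 1) :=
    isCompact_univ_pi fun _ => isCompact_univ_pi fun _ => isCompact_Icc
  refine hbox.of_isClosed_subset ?_ ?_
  · have : columnStochastic d = (⋂ i, ⋂ j, {Λ : Matrix (Fin d) (Fin d) ℝ | 0 ≤ Λ i j}) ∩
        ⋂ j, {Λ : Matrix (Fin d) (Fin d) ℝ | ∑ i, Λ i j = 1} := by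
      ext Λ; simp [columnStochastic]
    rw [this]
    refine (isClosed_iInter fun i => isClosed_iInter fun j =>
      isClosed_le continuous_const ?_).inter
      (isClosed_iInter fun j => isClosed_eq ?_ continuous_const)
    · exact (continuous_apply_apply i j)
    · exact continuous_finsetSum _ fun i _ => continuous_apply_apply i j
  · intro Λ hΛ i _ j _
    refine ⟨hΛ.1 i j, ?_⟩
    rw [← hΛ.2 j]
    exact Finset.single_le_sum (f := fun i => Λ i j) (fun k _ => hΛ.1 k j) (Finset.mem_univ i)

/-- Gibbs-preserving matrices do not increase the excess. -/
theorem excess_mulVec_le {γ : Fin d → ℝ} {Λ : Matrix (Fin d) (Fin d) ℝ}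
    (hΛ : IsGibbsPreserving γ Λ) (q : Fin d → ℝ) (c : ℝ) :
    excess γ (Λ *ᵥ q) c ≤ excess γ q c := by
  have hfix : ∀ i, γ i = ∑ j, Λ i j * γ j := fun i => (congrFun hΛ.fixed i).symm
  calc excess γ (Λ *ᵥ q) c ≤ ∑ i, ∑ j, Λ i j * max (q j - c * γ j) 0 := by
        refine Finset.sum_le_sum fun i _ => max_le ?_ ?_
        · have : (Λ *ᵥ q) i - c * γ i = ∑ j, Λ i j * (q j - c * γ j) := by
            rw [hfix i, Finset.mul_sum, Matrix.mulVec, dotProduct, ← Finset.sum_sub_distrib]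
            exact Finset.sum_congr rfl fun j _ => by ring
          rw [this]
          exact Finset.sum_le_sum fun j _ =>
            mul_le_mul_of_nonneg_left (le_max_left _ _) (hΛ.nonneg i j)
        · exact Finset.sum_nonneg fun j _ => mul_nonneg (hΛ.nonneg i j) (le_max_right _ _)
    _ = excess γ q c := by
        rw [Finset.sum_comm]
        exact Finset.sum_congr rfl fun j _ => by rw [← Finset.sum_mul, hΛ.col_sum, one_mul]

/-- Thermomajorisation: domination of the excess yields a Gibbs-preserving matrix. -/
theorem exists_isGibbsPreserving {γ p q : Fin d → ℝ} (hγ : ∀ i, 0 < γ i)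
    (hsum : ∑ i, p i = ∑ i, q i) (hle : ∀ c, excess γ p c ≤ excess γ q c) :
    ∃ Λ, IsGibbsPreserving γ Λ ∧ Λ *ᵥ q = p := by
  classical
  rcases Nat.eq_zero_or_pos d with rfl | hd
  · exact ⟨0, ⟨fun i => i.elim0, fun i => i.elim0, funext fun i => i.elim0⟩,
      funext fun i => i.elim0⟩
  have : NeZero d := ⟨hd.ne'⟩
  let T : Matrix (Fin d) (Fin d) ℝ →ₗ[ℝ] (Fin d → ℝ) × (Fin d → ℝ) :=
    { toFun := fun Λ => (Λ *ᵥ γ, Λ *ᵥ q)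
      map_add' := fun A B => by simp [Matrix.add_mulVec]
      map_smul' := fun a A => by simp [Matrix.smul_mulVec] }
  have hT : Continuous T := by
    change Continuous fun Λ : Matrix (Fin d) (Fin d) ℝ => (Λ *ᵥ γ, Λ *ᵥ q)
    fun_prop
  by_contra hcon
  have hnot : (γ, p) ∉ T '' columnStochastic d := by
    rintro ⟨Λ, hΛ, h⟩
    have h' : (Λ *ᵥ γ, Λ *ᵥ q) = (γ, p) := h
    rw [Prod.mk.injEq] at h'
    exact hcon ⟨Λ, ⟨hΛ.1, hΛ.2, h'.1⟩, h'.2⟩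
  obtain ⟨f, u, hu, hfu⟩ := geometric_hahn_banach_closed_point
    (convex_columnStochastic.linear_image T) (isCompact_columnStochastic.image hT).isClosed hnot
  set v : Fin d → ℝ := fun i => f (Pi.single i 1, 0)
  set a : Fin d → ℝ := fun i => f (0, Pi.single i 1)
  have hf : ∀ x y : Fin d → ℝ, f (x, y) = ∑ i, (v i * x i + a i * y i) := by
    intro x y
    have h : (x, y) = ∑ i, (x i • ((Pi.single i 1 : Fin d → ℝ), (0 : Fin d → ℝ)) +
        y i • ((0 : Fin d → ℝ), (Pi.single i 1 : Fin d → ℝ))) := by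
      ext j <;> simp [Prod.fst_sum, Prod.snd_sum, Finset.sum_apply, Pi.single_apply]
    rw [h, map_sum]
    refine Finset.sum_congr rfl fun i _ => ?_
    rw [map_add, map_smul, map_smul, smul_eq_mul, smul_eq_mul, mul_comm, mul_comm (y i)]
  -- The upper envelope of the affine functions defining the separating functional f: it bounds f at
  -- (γ, p) and is attained on the image of a deterministic matrix.
  let φ : ℝ → ℝ := fun x => univ.sup' univ_nonempty fun i => v i + a i * x
  have hφle : ∀ i x, v i + a i * x ≤ φ x := fun i x =>
    Finset.le_sup' (fun i => v i + a i * x) (Finset.mem_univ i)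
  have hφmem : ∀ x, ∃ i, φ x = v i + a i * x := fun x => by
    obtain ⟨i, -, hi⟩ := Finset.exists_mem_eq_sup' univ_nonempty fun i => v i + a i * x
    exact ⟨i, hi⟩
  have hφ : ∀ x, ∃ k, ∀ y, φ x + k * (y - x) ≤ φ y := fun x => by
    obtain ⟨i, hi⟩ := hφmem x
    exact ⟨a i, fun y => by linarith [hφle i y]⟩
  choose σ hσ using fun j => hφmem (q j / γ j)
  -- Column j puts all its weight on an index attaining φ at q j / γ j.
  let Λ : Matrix (Fin d) (Fin d) ℝ := fun i j => if i = σ j then 1 else 0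
  have hΛ : Λ ∈ columnStochastic d :=
    ⟨fun i j => by simp only [Λ]; split_ifs <;> norm_num, fun j => by simp [Λ]⟩
  have hval : f (T Λ) = ∑ j, γ j * φ (q j / γ j) := by
    change f (Λ *ᵥ γ, Λ *ᵥ q) = _
    rw [hf]
    simp only [Matrix.mulVec, dotProduct, Finset.mul_sum, ← Finset.sum_add_distrib]
    rw [Finset.sum_comm]
    refine Finset.sum_congr rfl fun j _ => ?_
    rw [Finset.sum_eq_single (σ j) (fun i _ hi => by simp [Λ, hi]) (by simp), hσ]
    have := (hγ j).ne'
    simp only [Λ, if_true]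
    field_simp
  have hp : f (γ, p) ≤ ∑ i, γ i * φ (p i / γ i) := by
    rw [hf]
    refine Finset.sum_le_sum fun i _ => ?_
    refine le_trans (le_of_eq ?_) (mul_le_mul_of_nonneg_left (hφle i (p i / γ i)) (hγ i).le)
    have := (hγ i).ne'
    field_simp
  have hlt := hu (T Λ) ⟨Λ, hΛ, rfl⟩
  have := sum_le_sum_of_excess_le hγ hsum hle φ hφ
  linarith

end Majorisation

/-! ### Vectors whose curve follows a line -/

section TangentVector

variable {ι : Type*} [Fintype ι] [DecidableEq ι]

/-- The vector whose thermomajorisation curve follows a line of slope `s` and intercept `b`, with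
first element `i` and last element `j`. -/
def lineVector (γ : ι → ℝ) (i j : ι) (s b : ℝ) : ι → ℝ :=
  s • γ + b • Pi.single i 1 - (s + b - 1) • Pi.single j 1

theorem sum_lineVector {γ : ι → ℝ} (hγ : ∑ i, γ i = 1) (i j : ι) (s b : ℝ) :
    ∑ k, lineVector γ i j s b k = 1 := by
  simp [lineVector, Finset.sum_add_distrib, Finset.sum_sub_distrib, ← Finset.mul_sum, hγ,
    Pi.single_apply]

theorem lineVector_combo {ι : Type*} [DecidableEq ι] (γ : ι → ℝ) (i j : ι) {a c : ℝ} (hac : a + c = 1) (s t b b' : ℝ) :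
    a • lineVector γ i j s b + c • lineVector γ i j t b' =
      lineVector γ i j (a * s + c * t) (a * b + c * b') := by
  ext k
  simp only [lineVector, Pi.add_apply, Pi.sub_apply, Pi.smul_apply, smul_eq_mul]
  linear_combination (-(Pi.single j (1 : ℝ) : ι → ℝ) k) * (-hac)

theorem excess_lineVector_le (γ : ι → ℝ) (i j : ι) {s b : ℝ} (hb : 0 ≤ b) (hc : 0 ≤ s + b - 1) :
    excess γ (lineVector γ i j s b) s ≤ b := by
  have h : ∀ k, max (lineVector γ i j s b k - s * γ k) 0 ≤ b * (Pi.single i (1 : ℝ) : ι → ℝ) k := by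
    intro k
    have h1 : 0 ≤ (Pi.single i (1 : ℝ) : ι → ℝ) k := by
      rw [Pi.single_apply]; split_ifs <;> norm_num
    have h2 : 0 ≤ (Pi.single j (1 : ℝ) : ι → ℝ) k := by
      rw [Pi.single_apply]; split_ifs <;> norm_num
    refine max_le ?_ (mul_nonneg hb h1)
    simp only [lineVector, Pi.add_apply, Pi.sub_apply, Pi.smul_apply, smul_eq_mul]
    nlinarith [mul_nonneg hc h2]
  calc excess γ (lineVector γ i j s b) s ≤ ∑ k, b * (Pi.single i (1 : ℝ) : ι → ℝ) k :=
        Finset.sum_le_sum fun k _ => h k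
    _ = b := by simp [Pi.single_apply]

/-- If `i` maximises and `j` minimises the ratio of `q` and `γ`, then every line above the
thermomajorisation curve of `q` gives a vector whose excess dominates that of `q`. -/
theorem excess_le_excess_lineVector {γ q : ι → ℝ} (hγ : ∀ k, 0 < γ k) (hγ1 : ∑ k, γ k = 1)
    (hq : ∑ k, q k = 1) {i j : ι} (hij : i ≠ j) (hi : ∀ k, q k / γ k ≤ q i / γ i)
    (hj : ∀ k, q j / γ j ≤ q k / γ k) {s b : ℝ} (hb : excess γ q s ≤ b) (u : ℝ) :
    excess γ q u ≤ excess γ (lineVector γ i j s b) u := by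
  have hti : lineVector γ i j s b i = s * γ i + b := by
    simp [lineVector, hij]
  have htj : lineVector γ i j s b j = s * γ j - (s + b - 1) := by
    simp [lineVector, hij.symm]
  rcases le_total s u with hsu | hus
  · rcases le_or_gt (q i) (u * γ i) with h | h
    · have : excess γ q u = 0 := by
        refine Finset.sum_eq_zero fun k _ => max_eq_right ?_
        have h1 := (hi k).trans ((div_le_iff₀ (hγ i)).2 h)
        linarith [(div_le_iff₀ (hγ k)).1 h1]
      rw [this]; exact excess_nonneg _ _ _
    · have hsγ : ∀ k, s * γ k ≤ u * γ k := fun k => mul_le_mul_of_nonneg_right hsu (hγ k).le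
      -- From s to u the term at i drops by exactly (u - s) * γ i and no other term grows; the entry
      -- of the line vector at i alone exceeds what remains.
      have h1 : excess γ q u ≤ excess γ q s - (u - s) * γ i := by
        unfold excess
        rw [← Finset.add_sum_erase _ _ (Finset.mem_univ i),
          ← Finset.add_sum_erase _ (fun k => max (q k - s * γ k) 0) (Finset.mem_univ i),
          max_eq_left (by linarith), max_eq_left (by linarith [hsγ i])]
        have : ∑ k ∈ univ.erase i, max (q k - u * γ k) 0 ≤
            ∑ k ∈ univ.erase i, max (q k - s * γ k) 0 :=
          Finset.sum_le_sum fun k _ => max_le_max_right _ (by linarith [hsγ k])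
        linarith
      have h2 : lineVector γ i j s b i - u * γ i ≤ excess γ (lineVector γ i j s b) u :=
        (le_max_left _ 0).trans (Finset.single_le_sum
          (f := fun k => max (lineVector γ i j s b k - u * γ k) 0)
          (fun k _ => le_max_right _ _) (Finset.mem_univ i))
      rw [hti] at h2
      linarith
  -- The mirror image: for u ≤ s the deficit plays the role of the excess and j that of i.
  · rw [excess_eq_deficit hγ1 hq, excess_eq_deficit hγ1 (sum_lineVector hγ1 i j s b)]
    rw [excess_eq_deficit hγ1 hq] at hb
    refine add_le_add_right ?_ _
    rcases le_or_gt (u * γ j) (q j) with h | h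
    · have : ∑ k, max (u * γ k - q k) 0 = 0 := by
        refine Finset.sum_eq_zero fun k _ => max_eq_right ?_
        have h1 := ((le_div_iff₀ (hγ j)).2 h).trans (hj k)
        linarith [(le_div_iff₀ (hγ k)).1 h1]
      rw [this]; exact Finset.sum_nonneg fun k _ => le_max_right _ _
    · have hsγ : ∀ k, u * γ k ≤ s * γ k := fun k => mul_le_mul_of_nonneg_right hus (hγ k).le
      have h1 : ∑ k, max (u * γ k - q k) 0 ≤ ∑ k, max (s * γ k - q k) 0 - (s - u) * γ j := by
        rw [← Finset.add_sum_erase _ _ (Finset.mem_univ j),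
          ← Finset.add_sum_erase _ (fun k => max (s * γ k - q k) 0) (Finset.mem_univ j),
          max_eq_left (by linarith), max_eq_left (by linarith [hsγ j])]
        have : ∑ k ∈ univ.erase j, max (u * γ k - q k) 0 ≤
            ∑ k ∈ univ.erase j, max (s * γ k - q k) 0 :=
          Finset.sum_le_sum fun k _ => max_le_max_right _ (by linarith [hsγ k])
        linarith
      have h2 : u * γ j - lineVector γ i j s b j ≤
          ∑ k, max (u * γ k - lineVector γ i j s b k) 0 :=
        (le_max_left _ 0).trans (Finset.single_le_sum
          (f := fun k => max (u * γ k - lineVector γ i j s b k) 0)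
          (fun k _ => le_max_right _ _) (Finset.mem_univ j))
      rw [htj] at h2
      linarith

/-- Distinct indices that maximise and minimise a function. -/
theorem exists_ne_max_min [Nontrivial ι] (f : ι → ℝ) :
    ∃ i j, i ≠ j ∧ (∀ k, f k ≤ f i) ∧ ∀ k, f j ≤ f k := by
  obtain ⟨i, hi⟩ := Finite.exists_max f
  obtain ⟨j, hj⟩ := Finite.exists_min f
  by_cases hij : i = j
  · subst hij
    obtain ⟨k, hk⟩ := exists_ne i
    have hconst : ∀ l, f l = f i := fun l => le_antisymm (hi l) (hj l)
    exact ⟨i, k, hk.symm, hi, fun l => by rw [hconst k, hconst l]⟩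
  · exact ⟨i, j, hij, hi, hj⟩

/-- Moving weight from a smallest to a largest ratio strictly increases the excess in between. -/
theorem excess_transfer {γ q : ι → ℝ} {i j : ι} (hij : i ≠ j) {s ε : ℝ} (hε : 0 ≤ ε)
    (hi : s * γ i ≤ q i) (hj : q j ≤ s * γ j) :
    excess γ (q + ε • (Pi.single i 1 - Pi.single j 1)) s = excess γ q s + ε := by
  have h : ∀ k, max ((q + ε • (Pi.single i (1 : ℝ) - Pi.single j 1) : ι → ℝ) k - s * γ k) 0 =
      max (q k - s * γ k) 0 + ε * (Pi.single i (1 : ℝ) : ι → ℝ) k := by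
    intro k
    by_cases hki : k = i
    · subst hki
      simp only [Pi.add_apply, Pi.smul_apply, Pi.sub_apply, Pi.single_eq_same,
        Pi.single_eq_of_ne hij, smul_eq_mul]
      rw [max_eq_left (by linarith), max_eq_left (by linarith)]; ring
    · by_cases hkj : k = j
      · subst hkj
        simp only [Pi.add_apply, Pi.smul_apply, Pi.sub_apply, Pi.single_eq_same,
          Pi.single_eq_of_ne hki, smul_eq_mul]
        rw [max_eq_right (by linarith), max_eq_right (by linarith)]; ring
      · simp [Pi.single_eq_of_ne hki, Pi.single_eq_of_ne hkj]
  unfold excess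
  rw [Finset.sum_congr rfl fun k _ => h k, Finset.sum_add_distrib, ← Finset.mul_sum]
  simp [Pi.single_apply]

end TangentVector

/-! ### The tangent set described by the excess -/

section TangentSet

variable {d : ℕ} {β : ℝ} {E p : Fin d → ℝ} {πp : Equiv.Perm (Fin d)}

theorem gibbs_pos (β : ℝ) (E : Fin d → ℝ) (i : Fin d) : 0 < gibbs β E i :=
  div_pos (Real.exp_pos _) (Finset.sum_pos (fun _ _ => Real.exp_pos _) ⟨i, Finset.mem_univ i⟩)

theorem sum_gibbs (hd : 0 < d) (β : ℝ) (E : Fin d → ℝ) : ∑ i, gibbs β E i = 1 := by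
  unfold gibbs
  rw [← Finset.sum_div]
  exact div_self (Finset.sum_pos (fun _ _ => Real.exp_pos _) ⟨⟨0, hd⟩, Finset.mem_univ _⟩).ne'

theorem slope_mul (n : Fin d) : slope β E p πp n * gibbs β E (πp.symm n) = p (πp.symm n) :=
  div_mul_cancel₀ _ (gibbs_pos β E _).ne'

/-- On the slopes supporting the curve of `p` at its `n`-th vertex the excess of `p` is affine. -/
theorem excess_eq_of_slope (hπp : IsBetaOrder β E p πp) (n : Fin d) {s : ℝ}
    (hle : s ≤ slope β E p πp n) (hge : ∀ k, n < k → slope β E p πp k ≤ s) :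
    excess (gibbs β E) p s = (∑ i ∈ Finset.Iic n, p (πp.symm i)) -
      s * ∑ i ∈ Finset.Iic n, gibbs β E (πp.symm i) := by
  have hanti : Antitone (slope β E p πp) := hπp
  unfold excess
  rw [← Equiv.sum_comp πp.symm, Finset.mul_sum, ← Finset.sum_sub_distrib,
    ← Finset.sum_subset (Finset.subset_univ (Finset.Iic n))]
  · refine Finset.sum_congr rfl fun k hk => max_eq_left ?_
    have h := mul_le_mul_of_nonneg_right (hle.trans (hanti (Finset.mem_Iic.1 hk)))
      (gibbs_pos β E (πp.symm k)).le
    rw [slope_mul] at h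
    linarith
  · intro k _ hk
    have h := mul_le_mul_of_nonneg_right (hge k (not_le.1 fun h => hk (Finset.mem_Iic.2 h)))
      (gibbs_pos β E (πp.symm k)).le
    rw [slope_mul] at h
    exact max_eq_right (by linarith)

/-- The line of slope `slope β E p πp n` touching the curve of p has as intercept the excess of p at
that slope. Only the first and last elements of π matter. -/
theorem tangent_eq_lineVector (hπp : IsBetaOrder β E p πp) (hd : 1 < d) (n : Fin d)
    (π : Equiv.Perm (Fin d)) :
    tangent β E p πp n π = lineVector (gibbs β E) (π ⟨0, by omega⟩) (π ⟨d - 1, by omega⟩)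
      (slope β E p πp n) (excess (gibbs β E) p (slope β E p πp n)) := by
  have hex := excess_eq_of_slope hπp n le_rfl fun k hk => hπp hk.le
  set s := slope β E p πp n with hs
  set b := excess (gibbs β E) p s with hb
  have hfirst : ∀ x, firstEntry β E p πp n x = b + s * x := fun x => by
    rw [firstEntry, hex, ← hs]; ring
  have hsum : gibbs β E (π ⟨0, by omega⟩) +
      ∑ j ∈ Finset.univ.filter (fun j : Fin d => 0 < j.val ∧ j.val + 1 < d), gibbs β E (π j) +
      gibbs β E (π ⟨d - 1, by omega⟩) = 1 := by
    have hmid : Finset.univ.filter (fun j : Fin d => 0 < j.val ∧ j.val + 1 < d) =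
        (univ.erase ⟨0, by omega⟩).erase ⟨d - 1, by omega⟩ := by
      ext j
      simp only [Finset.mem_filter, Finset.mem_univ, true_and, Finset.mem_erase, Fin.ext_iff, ne_eq,
        and_true]
      omega
    have hlast : (⟨d - 1, by omega⟩ : Fin d) ∈ univ.erase (⟨0, by omega⟩ : Fin d) := by
      simp only [Finset.mem_erase, Finset.mem_univ, Fin.ext_iff, ne_eq, and_true]
      omega
    rw [hmid, add_assoc, Finset.sum_erase_add _ (fun j => gibbs β E (π j)) hlast,
      Finset.add_sum_erase _ (fun j => gibbs β E (π j)) (Finset.mem_univ _),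
      Equiv.sum_comp π (gibbs β E), sum_gibbs (by omega) β E]
  ext l
  obtain ⟨i, rfl⟩ := π.surjective l
  simp only [tangent, Equiv.symm_apply_apply, tangentOrdered, lineVector, Pi.add_apply,
    Pi.sub_apply, Pi.smul_apply, smul_eq_mul, Pi.single_apply, EmbeddingLike.apply_eq_iff_eq,
    Fin.ext_iff, hfirst, ← hs]
  have hi := i.isLt
  split_ifs with h1 h2 h3 <;> first | omega | skip
  · ring
  · ring
  · have : i = ⟨d - 1, by omega⟩ := Fin.ext (by assumption)
    rw [this]
    linear_combination -s * hsum

theorem exists_slope_between {c : ℝ} (hπp : IsBetaOrder β E p πp) {i j : Fin d}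
    (hi : c * gibbs β E i < p i) (hj : p j < c * gibbs β E j) :
    ∃ n, ∃ h : n + 1 < d, slope β E p πp ⟨n + 1, h⟩ ≤ c ∧
      c ≤ slope β E p πp ⟨n, Nat.lt_of_succ_lt h⟩ := by
  classical
  -- The first index with slope at most c is the wanted n + 1; it is not 0, since i has ratio above
  -- c.
  have hex : ∃ k, ∃ h : k < d, slope β E p πp ⟨k, h⟩ ≤ c := by
    refine ⟨(πp j).val, (πp j).isLt, ?_⟩
    simp only [slope, Fin.eta, Equiv.symm_apply_apply]
    exact ((div_lt_iff₀ (gibbs_pos β E j)).2 hj).le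
  obtain ⟨h, hk⟩ := Nat.find_spec hex
  have hmin := fun m => Nat.find_min hex (m := m)
  rcases hm : Nat.find hex with _ | n
  · simp only [hm] at hk h
    have h1 : slope β E p πp (πp i) ≤ slope β E p πp ⟨0, h⟩ := hπp (Fin.mk_le_of_le_val (by simp))
    have h2 : c < slope β E p πp (πp i) := by
      simp only [slope, Equiv.symm_apply_apply]
      exact (lt_div_iff₀ (gibbs_pos β E i)).2 hi
    linarith
  · simp only [hm] at hk h hmin
    refine ⟨n, h, hk, ?_⟩
    by_contra hcon
    exact hmin n (Nat.lt_succ_self n) ⟨Nat.lt_of_succ_lt h, (not_le.1 hcon).le⟩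

theorem excess_eq_of_mem_Icc (hπp : IsBetaOrder β E p πp) {n : ℕ} (h : n + 1 < d) {s : ℝ}
    (h1 : slope β E p πp ⟨n + 1, h⟩ ≤ s) (h2 : s ≤ slope β E p πp ⟨n, Nat.lt_of_succ_lt h⟩) :
    excess (gibbs β E) p s =
      (∑ i ∈ Finset.Iic (⟨n, Nat.lt_of_succ_lt h⟩ : Fin d), p (πp.symm i)) -
      s * ∑ i ∈ Finset.Iic (⟨n, Nat.lt_of_succ_lt h⟩ : Fin d), gibbs β E (πp.symm i) :=
  excess_eq_of_slope hπp _ h2 fun k hk => (hπp (a := ⟨n + 1, h⟩) (b := k) hk).trans h1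

theorem excess_combo_of_slope (hπp : IsBetaOrder β E p πp) {n : ℕ} (h : n + 1 < d) {a c : ℝ}
    (ha : 0 ≤ a) (hc : 0 ≤ c) (hac : a + c = 1) :
    excess (gibbs β E) p (a * slope β E p πp ⟨n, Nat.lt_of_succ_lt h⟩ +
        c * slope β E p πp ⟨n + 1, h⟩) =
      a * excess (gibbs β E) p (slope β E p πp ⟨n, Nat.lt_of_succ_lt h⟩) +
        c * excess (gibbs β E) p (slope β E p πp ⟨n + 1, h⟩) := by
  have hle : slope β E p πp ⟨n + 1, h⟩ ≤ slope β E p πp ⟨n, Nat.lt_of_succ_lt h⟩ :=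
    hπp (Fin.mk_le_mk.2 (Nat.le_succ n))
  obtain rfl : a = 1 - c := by linarith
  rw [excess_eq_of_mem_Icc hπp h hle le_rfl, excess_eq_of_mem_Icc hπp h le_rfl hle,
    excess_eq_of_mem_Icc hπp h (by nlinarith) (by nlinarith)]
  ring

/-- A point of the tangent set has at most the excess of `p` at some slope of the curve of `p`. -/
theorem exists_excess_le_of_mem_tangentSet (hp : ∑ i, p i = 1) (hπp : IsBetaOrder β E p πp)
    {q : Fin d → ℝ} (hq : q ∈ tangentSet β E p πp) :
    ∃ n, ∃ h : n + 1 < d, ∃ s, slope β E p πp ⟨n + 1, h⟩ ≤ s ∧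
      s ≤ slope β E p πp ⟨n, Nat.lt_of_succ_lt h⟩ ∧
      excess (gibbs β E) q s ≤ excess (gibbs β E) p s := by
  simp only [tangentSet, Set.mem_iUnion] at hq
  obtain ⟨π, n, h, hq⟩ := hq
  refine ⟨n, h, ?_⟩
  have hle : slope β E p πp ⟨n + 1, h⟩ ≤ slope β E p πp ⟨n, Nat.lt_of_succ_lt h⟩ :=
    hπp (Fin.mk_le_mk.2 (Nat.le_succ n))
  have hcone : ∀ m : Fin d, ∀ r ∈ futureCone β E (tangent β E p πp m π),
      excess (gibbs β E) r (slope β E p πp m) ≤ excess (gibbs β E) p (slope β E p πp m) := by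
    rintro m r ⟨Λ, hΛ, rfl⟩
    refine (excess_mulVec_le hΛ _ _).trans ?_
    rw [tangent_eq_lineVector hπp (by omega)]
    refine excess_lineVector_le _ _ _ (excess_nonneg _ _ _) ?_
    linarith [one_sub_le_excess (sum_gibbs (by omega : 0 < d) β E) hp (slope β E p πp m)]
  refine convexHull_min (t := {q | ∃ s, slope β E p πp ⟨n + 1, h⟩ ≤ s ∧
    s ≤ slope β E p πp ⟨n, Nat.lt_of_succ_lt h⟩ ∧
    excess (gibbs β E) q s ≤ excess (gibbs β E) p s}) ?_ ?_ hq
  · rintro r (hr | hr)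
    · exact ⟨_, hle, le_rfl, hcone _ r hr⟩
    · exact ⟨_, le_rfl, hle, hcone _ r hr⟩
  · rintro q ⟨s, hs1, hs2, hs⟩ r ⟨t, ht1, ht2, ht⟩ a c ha hc hac
    have h1 : slope β E p πp ⟨n + 1, h⟩ ≤ a * s + c * t := by
      obtain rfl : a = 1 - c := by linarith
      nlinarith
    have h2 : a * s + c * t ≤ slope β E p πp ⟨n, Nat.lt_of_succ_lt h⟩ := by
      obtain rfl : a = 1 - c := by linarith
      nlinarith
    refine ⟨a * s + c * t, h1, h2, (excess_combo_le _ q r ha hc s t).trans ?_⟩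
    refine (add_le_add (mul_le_mul_of_nonneg_left hs ha)
      (mul_le_mul_of_nonneg_left ht hc)).trans (le_of_eq ?_)
    rw [excess_eq_of_mem_Icc hπp h hs1 hs2, excess_eq_of_mem_Icc hπp h ht1 ht2,
      excess_eq_of_mem_Icc hπp h h1 h2]
    obtain rfl : a = 1 - c := by linarith
    ring

theorem mem_tangentSet_of_excess_le (hπp : IsBetaOrder β E p πp) {q : Fin d → ℝ}
    (hq : ∑ i, q i = 1) {n : ℕ} (h : n + 1 < d) {s : ℝ} (h1 : slope β E p πp ⟨n + 1, h⟩ ≤ s)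
    (h2 : s ≤ slope β E p πp ⟨n, Nat.lt_of_succ_lt h⟩)
    (hle : excess (gibbs β E) q s ≤ excess (gibbs β E) p s) : q ∈ tangentSet β E p πp := by
  have hd : 1 < d := by omega
  have : Nontrivial (Fin d) := Fin.nontrivial_iff_two_le.2 hd
  obtain ⟨i, j, hij, hi, hj⟩ := exists_ne_max_min fun k => q k / gibbs β E k
  have h0 : (⟨0, by omega⟩ : Fin d) ≠ ⟨d - 1, by omega⟩ := by
    simp [Fin.ext_iff]; omega
  obtain ⟨π, hπ0, hπ1⟩ : ∃ π : Equiv.Perm (Fin d),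
      π ⟨0, by omega⟩ = i ∧ π ⟨d - 1, by omega⟩ = j := by
    let τ := Equiv.swap (⟨0, by omega⟩ : Fin d) i
    have hτ : τ ⟨d - 1, by omega⟩ ≠ i := fun hh => h0 (τ.injective (by
      rw [hh]; exact Equiv.swap_apply_left _ _))
    refine ⟨τ.trans (Equiv.swap (τ ⟨d - 1, by omega⟩) j), ?_, ?_⟩
    · rw [Equiv.trans_apply, Equiv.swap_apply_left,
        Equiv.swap_apply_of_ne_of_ne hτ.symm hij]
    · rw [Equiv.trans_apply, Equiv.swap_apply_left]
  have hseg : s ∈ segment ℝ (slope β E p πp ⟨n, Nat.lt_of_succ_lt h⟩)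
      (slope β E p πp ⟨n + 1, h⟩) := by
    rw [segment_symm, segment_eq_Icc (h1.trans h2)]; exact ⟨h1, h2⟩
  obtain ⟨a, c, ha, hc, hac, hs⟩ := hseg
  simp only [smul_eq_mul] at hs
  have hsum := sum_gibbs (by omega : 0 < d) β E
  obtain ⟨Λ, hΛ, hΛq⟩ := exists_isGibbsPreserving (gibbs_pos β E)
    (hq.trans (sum_lineVector hsum i j s (excess (gibbs β E) p s)).symm)
    (excess_le_excess_lineVector (gibbs_pos β E) hsum hq hij hi hj hle)
  rw [← hs, excess_combo_of_slope hπp h ha hc hac, ← lineVector_combo _ _ _ hac, ← hπ0, ← hπ1,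
    ← tangent_eq_lineVector hπp hd, ← tangent_eq_lineVector hπp hd, Matrix.mulVec_add,
    Matrix.mulVec_smul, Matrix.mulVec_smul] at hΛq
  simp only [tangentSet, Set.mem_iUnion]
  refine ⟨π, n, h, ?_⟩
  rw [← hΛq]
  refine convex_convexHull ℝ _ ?_ ?_ ha hc hac
  · exact subset_convexHull ℝ _ (Set.mem_union_left _ ⟨Λ, hΛ, rfl⟩)
  · exact subset_convexHull ℝ _ (Set.mem_union_right _ ⟨Λ, hΛ, rfl⟩)

theorem mem_normalisedInterior {S : Set (Fin d → ℝ)} {q : Fin d → ℝ} :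
    q ∈ normalisedInterior S ↔
      ∑ i, q i = 1 ∧ ∃ U, IsOpen U ∧ q ∈ U ∧ ∀ r ∈ U, ∑ i, r i = 1 → r ∈ S := by
  constructor
  · rintro ⟨⟨q, hq⟩, hqS, rfl⟩
    obtain ⟨V, hVS, hV, hqV⟩ := mem_interior.1 hqS
    obtain ⟨U, hU, rfl⟩ := isOpen_induced_iff.1 hV
    exact ⟨hq, U, hU, hqV, fun r hr hr1 => hVS (a := ⟨r, hr1⟩) hr⟩
  · rintro ⟨hq, U, hU, hqU, hUS⟩
    exact ⟨⟨q, hq⟩, mem_interior.2 ⟨Subtype.val ⁻¹' U, fun r hr => hUS r.1 hr r.2,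
      hU.preimage continuous_subtype_val, hqU⟩, rfl⟩

theorem exists_lt_of_excess_lt {ι : Type*} [Fintype ι] {γ p q : ι → ℝ} (hγ : ∑ i, γ i = 1)
    (hp : ∑ i, p i = 1) (hq : ∑ i, q i = 1) {c : ℝ} (h : excess γ q c < excess γ p c) :
    (∃ i, c * γ i < p i) ∧ ∃ j, p j < c * γ j := by
  constructor
  · by_contra! hcon
    have : excess γ p c = 0 := Finset.sum_eq_zero fun i _ => max_eq_right (by linarith [hcon i])
    linarith [excess_nonneg γ q c]
  · by_contra! hcon
    have : excess γ p c = 1 - c := by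
      rw [excess_eq_deficit hγ hp, Finset.sum_eq_zero, add_zero]
      exact fun i _ => max_eq_right (by linarith [hcon i])
    linarith [one_sub_le_excess hγ hq c]

theorem mem_normalisedInterior_of_excess_lt (hd : 0 < d) (hp : ∑ i, p i = 1)
    (hπp : IsBetaOrder β E p πp) {q : Fin d → ℝ} (hq : ∑ i, q i = 1) {c : ℝ}
    (h : excess (gibbs β E) q c < excess (gibbs β E) p c) :
    q ∈ normalisedInterior (tangentSet β E p πp) := by
  obtain ⟨⟨i, hi⟩, j, hj⟩ := exists_lt_of_excess_lt (sum_gibbs hd β E) hp hq h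
  obtain ⟨n, hn, h1, h2⟩ := exists_slope_between hπp hi hj
  exact mem_normalisedInterior.2 ⟨hq, {r | excess (gibbs β E) r c < excess (gibbs β E) p c},
    isOpen_lt (continuous_excess _ c) continuous_const, h,
    fun r hr hr1 => mem_tangentSet_of_excess_le hπp hr1 hn h1 h2 (le_of_lt hr)⟩

theorem notMem_normalisedInterior_of_mulVec_eq (hp : ∑ i, p i = 1) (hπp : IsBetaOrder β E p πp)
    {q : Fin d → ℝ} {Λ : Matrix (Fin d) (Fin d) ℝ} (hΛ : IsGibbsPreserving (gibbs β E) Λ)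
    (hΛq : Λ *ᵥ q = p) : q ∉ normalisedInterior (tangentSet β E p πp) := by
  intro hint
  obtain ⟨hq, U, hU, hqU, hUS⟩ := mem_normalisedInterior.1 hint
  have hd : 1 < d := by
    obtain ⟨n, h, -⟩ := exists_excess_le_of_mem_tangentSet hp hπp (hUS q hqU hq)
    omega
  have : Nontrivial (Fin d) := Fin.nontrivial_iff_two_le.2 hd
  obtain ⟨i, j, hij, hi, hj⟩ := exists_ne_max_min fun k => q k / gibbs β E k
  let v : Fin d → ℝ := Pi.single i 1 - Pi.single j 1
  have hcont : Continuous fun ε : ℝ => q + ε • v := by fun_prop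
  have hnear : ∀ᶠ ε in nhdsWithin (0 : ℝ) (Set.Ioi 0), q + ε • v ∈ U :=
    (hcont.continuousAt.eventually_mem (hU.mem_nhds (by simpa using hqU))).filter_mono
      nhdsWithin_le_nhds
  obtain ⟨ε, hεU, hε⟩ := (hnear.and self_mem_nhdsWithin).exists
  have hε : 0 < ε := hε
  have hsum : ∑ k, (q + ε • v) k = 1 := by
    simp [v, Finset.sum_add_distrib, ← Finset.mul_sum, hq, Pi.single_apply]
  obtain ⟨n, h, s, hs1, hs2, hs⟩ := exists_excess_le_of_mem_tangentSet hp hπp (hUS _ hεU hsum)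
  have hpΛ : ∀ k, p k = ∑ l, Λ k l * q l := fun k => (congrFun hΛq k).symm
  have hγΛ : ∀ k, gibbs β E k = ∑ l, Λ k l * gibbs β E l := fun k => (congrFun hΛ.fixed k).symm
  have hupper : ∀ k, p k / gibbs β E k ≤ q i / gibbs β E i := fun k => by
    rw [div_le_iff₀ (gibbs_pos β E k), hpΛ, hγΛ k, Finset.mul_sum]
    refine Finset.sum_le_sum fun l _ => ?_
    rw [mul_left_comm]
    exact mul_le_mul_of_nonneg_left ((div_le_iff₀ (gibbs_pos β E l)).1 (hi l)) (hΛ.nonneg k l)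
  have hlower : ∀ k, q j / gibbs β E j ≤ p k / gibbs β E k := fun k => by
    rw [le_div_iff₀ (gibbs_pos β E k), hpΛ, hγΛ k, Finset.mul_sum]
    refine Finset.sum_le_sum fun l _ => ?_
    rw [mul_left_comm]
    exact mul_le_mul_of_nonneg_left ((le_div_iff₀ (gibbs_pos β E l)).1 (hj l)) (hΛ.nonneg k l)
  have htrans := excess_transfer (γ := gibbs β E) hij hε.le
    ((le_div_iff₀ (gibbs_pos β E i)).1 (hs2.trans (hupper _)))
    ((div_le_iff₀ (gibbs_pos β E j)).1 ((hlower _).trans hs1))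
  have hmono := excess_mulVec_le hΛ q s
  rw [hΛq] at hmono
  linarith

end TangentSet

end ThermalCone

theorem mainTheorem3 (d : ℕ) (β : ℝ) (hβ : 0 < β) (E p : Fin d → ℝ)
    (hp : p ∈ stdSimplex ℝ (Fin d)) (πp : Equiv.Perm (Fin d))
    (hπp : ThermalCone.IsBetaOrder β E p πp) :
    ThermalCone.pastCone β E p =
      stdSimplex ℝ (Fin d) \ ThermalCone.normalisedInterior (ThermalCone.tangentSet β E p πp) := by
  have hd : 0 < d := by
    rcases Nat.eq_zero_or_pos d with rfl | hd
    · exact absurd hp.2 (by simp)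
    · exact hd
  ext q
  constructor
  · rintro ⟨hq, Λ, hΛ, hΛq⟩
    exact ⟨hq, ThermalCone.notMem_normalisedInterior_of_mulVec_eq hp.2 hπp hΛ hΛq⟩
  · rintro ⟨hq, hint⟩
    refine ⟨hq, ThermalCone.exists_isGibbsPreserving (ThermalCone.gibbs_pos β E)
      (hp.2.trans hq.2.symm) fun c => ?_⟩
    by_contra hcon
    exact hint (ThermalCone.mem_normalisedInterior_of_excess_lt hd hp.2 hπp hq.2 (not_le.1 hcon))
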